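/- Words are elements of $\mathbb F_2^n$ with the Hamming distance $d$; $B_t(x)$ is the Hamming ball of radius $t$ about $x$, and $V(n,t)=\sum_{i=0}^t\binom ni$. A code $C\subseteq\mathbb F_2^n$ with at least two codewords is called $e$-error-correcting if $\lfloor (d_{\min}(C)-1)/2\rfloor=e$. Let $e\ge 0$ and $\ell\ge 1$ be integers and put $t=e+\ell$. A codeword $x\in C$ is sent through $N$ channels, which return a set $Y\subseteq B_t(x)$ of $N$ distinct words. A list decoder assigns to each such $Y$ a finite list of words; it is successful if the list always contains $x$. Let $\mathcal L=\mathcal L(C,N)$ be the minimum, over all successful decoders, of the maximum length of the list over all possible output sets $Y$. Write $T(Y)=C\cap\bigcap_{y\in Y}B_t(y)$, and let $N_h=N(n,\ell,e,h)$ be the maximum number $N$ for which there are an $e$-error-correcting code $C\subseteq\mathbb F_2^n$ and a set $Y$ of $N$ output words with $|T(Y)|\ge h$. For an integer $b$ put $$n(e,\ell,b)=(\ell-1)^2\left(b-e+(e+1)\left(b-3e-2e^2+eb+\binom{b-2e-1}{2}\right)\right)+\ell-2.$$ Let $3\le h\le \ell$, let $b\ge\max\{3t,4e+4\}$ be an integer,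 and let $n\ge n(e,\ell,b)$. Then the maximum $N_h$ exists, and if $N\ge N_h+1$, then $\mathcal L(C,N)\le h-1$ for every $e$-error-correcting code $C\subseteq\mathbb F_2^n$. Moreover, $$N_h = V(n,\ell-1)+\binom{n-h(e+1)}{\ell+1-h}(e+1)^h+\Theta\left(n^{\ell-h}\right),$$ that is, there are constants $c_1,c_2>0$, depending only on $e,\ell,h$, such that for all such $b$ and $n$ $$c_1n^{\ell-h}\le N_h-V(n,\ell-1)-\binom{n-h(e+1)}{\ell+1-h}(e+1)^h\le c_2n^{\ell-h}.$$ -/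

import Mathlib

namespace SequenceReconstruction

/-- The binary Hamming space of words of length `n`. -/
abbrev Word (n : ℕ) : Type := Fin n → ZMod 2

/-- The Hamming ball of radius `t` centred at `x`. -/
def ball {n : ℕ} (t : ℕ) (x : Word n) : Finset (Word n) :=
  Finset.univ.filter fun y => hammingDist x y ≤ t

/-- `V(n, t)`, the cardinality of a Hamming ball of radius `t`. -/
def ballVolume (n t : ℕ) : ℕ := ∑ i ∈ Finset.range (t + 1), n.choose i

/-- The minimum distance of a code with at least two codewords. -/
noncomputable def minDist {n : ℕ} (C : Finset (Word n)) : ℕ :=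
  sInf {d | ∃ x ∈ C, ∃ y ∈ C, x ≠ y ∧ hammingDist x y = d}

/-- `C` is an `e`-error-correcting code: it has at least two codewords (so that its minimum
distance exists) and its error-correcting capability `⌊(d_min(C) - 1) / 2⌋` is `e`. -/
def IsErrorCorrecting {n : ℕ} (e : ℕ) (C : Finset (Word n)) : Prop :=
  C.Nontrivial ∧ (minDist C - 1) / 2 = e

/-- The possible sets of outputs of `N` channels: sets of `N` words that lie within distance `t`
of some transmitted codeword. -/
def outputSets {n : ℕ} (C : Finset (Word n)) (t N : ℕ) : Finset (Finset (Word n)) :=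
  Finset.univ.filter fun Y => Y.card = N ∧ ∃ x ∈ C, Y ⊆ ball t x

/-- The list decoder `D` is successful: its list always contains the transmitted codeword. -/
def IsSuccessful {n : ℕ} (C : Finset (Word n)) (t N : ℕ)
    (D : Finset (Word n) → Finset (Word n)) : Prop :=
  ∀ x ∈ C, ∀ Y : Finset (Word n), Y.card = N → Y ⊆ ball t x → x ∈ D Y

/-- The largest list that the decoder `D` gives on a possible set of outputs. -/
def decoderListSize {n : ℕ} (C : Finset (Word n)) (t N : ℕ)
    (D : Finset (Word n) → Finset (Word n)) : ℕ :=
  (outputSets C t N).sup fun Y => (D Y).card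

/-- The list size `𝓛`: the smallest value of `decoderListSize` over all successful decoders. -/
noncomputable def listSize {n : ℕ} (C : Finset (Word n)) (t N : ℕ) : ℕ :=
  sInf {L | ∃ D, IsSuccessful C t N D ∧ decoderListSize C t N D = L}

/-- `T(Y)`, the set of codewords within distance `t` of every word of `Y`. -/
def candidates {n : ℕ} (C : Finset (Word n)) (t : ℕ) (Y : Finset (Word n)) : Finset (Word n) :=
  C.filter fun c => ∀ y ∈ Y, c ∈ ball t y

/-- The numbers `N` of `(e + ℓ)`-error channels for which some `e`-error-correcting code `C` and
some set `Y` of `N` output words satisfy `|T(Y)| ≥ h`. -/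
def channelCounts (n ℓ e h : ℕ) : Set ℕ :=
  {N | ∃ C : Finset (Word n), IsErrorCorrecting e C ∧
    ∃ Y ∈ outputSets C (e + ℓ) N, h ≤ (candidates C (e + ℓ) Y).card}

/-- `N_h`, the maximum of `channelCounts n ℓ e h`. -/
noncomputable def maxChannels (n ℓ e h : ℕ) : ℕ := sSup (channelCounts n ℓ e h)

/-- The bound `n(e, ℓ, b)` on the length. -/
def lengthBound (e ℓ b : ℕ) : ℤ :=
  ((ℓ : ℤ) - 1) ^ 2 *
    ((b : ℤ) - e + (e + 1) * ((b : ℤ) - 3 * e - 2 * e ^ 2 + e * b + ((b - 2 * e - 1).choose 2 : ℕ)))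
    + ℓ - 2

/-- The remainder `N_h - V(n, ℓ - 1) - C(n - h (e + 1), ℓ + 1 - h) (e + 1) ^ h`. -/
noncomputable def remainder (n ℓ e h : ℕ) : ℝ :=
  (maxChannels n ℓ e h : ℝ) - (ballVolume n (ℓ - 1) : ℝ)
    - ((n - h * (e + 1)).choose (ℓ + 1 - h) : ℝ) * ((e : ℝ) + 1) ^ h

end SequenceReconstruction

open Finset
open scoped symmDiff

namespace SequenceReconstruction

/-! ### Counting sets by their traces on a fixed union -/

section Counting

variable {α : Type*}

/-! Identify words with their supports. Then `N_h` is governed by how many sets `y` can lie within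
`t = e + ℓ` of `h` sets that are pairwise at distance at least `2e + 1`; let `M` be the union of
these `h` sets.

Suppose first that they have a common centre at distance at most `e + 1`, moved to `∅`. They are
then disjoint of size `e + 1`, except perhaps one of size `e`. Sets `y` of size below `ℓ` number
`V(n, ℓ - 1)`. A larger `y` must meet the members so often that at most `ℓ + 1 - h` of its points
lie outside `M`. Equality forces one of `(e + 1)^h` traces, which gives the main term; all other `y`
number `O(n^(ℓ-h))` (`trace_dichotomy`).

Without such a centre, the trace of `y` on `M` is at least `e + 2` away from some member, so at most
`ℓ - 2` points lie outside. The resulting `O(n^(ℓ-2))` is below `V(n, ℓ - 1)` for large `n`.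

Conversely, for `h` disjoint sets of size `e + 1`, the sets `y` with one point in each member and `ℓ
+ 1 - h` or `ℓ - h` points outside supply the main term and the lower bound on the error
(`le_card_commonBall`). -/

theorem card_filter_card_le [Fintype α] (k : ℕ) :
    #{y : Finset α | #y ≤ k} = ballVolume (Fintype.card α) k := by
  rw [ballVolume, Finset.card_eq_sum_card_fiberwise (f := fun y : Finset α => #y)
    (t := range (k + 1))]
  · refine sum_congr rfl fun i hi => ?_
    rw [← Finset.card_univ, ← card_powersetCard]
    congr 1
    ext y
    simp only [mem_filter, mem_univ, true_and, mem_powersetCard, subset_univ]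
    have := mem_range.1 hi
    omega
  · intro y hy
    have : #y ≤ k := by simpa using hy
    simpa using Nat.lt_succ_of_le this

variable [DecidableEq α]

theorem card_filter_inter_mem [Fintype α] (M : Finset α) (G : Finset (Finset α)) (hG : G ⊆ M.powerset)
    (k : ℕ) :
    #{y : Finset α | y ∩ M ∈ G ∧ #(y \ M) = k} = #G * (Fintype.card α - #M).choose k := by
  rw [← card_compl, ← card_powersetCard, ← card_product]
  refine card_nbij' (fun y => (y ∩ M, y \ M)) (fun p => p.1 ∪ p.2) ?_ ?_ ?_ ?_
  · intro y hy
    simp only [coe_filter, mem_univ, true_and, Set.mem_ofPred_eq] at hy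
    simp only [coe_product, Set.mem_prod, mem_coe, mem_powersetCard]
    refine ⟨hy.1, ?_, hy.2⟩
    intro a ha
    simp at ha ⊢
    exact ha.2
  · rintro ⟨u, v⟩ hp
    simp only [coe_product, Set.mem_prod, mem_coe, mem_powersetCard] at hp
    obtain ⟨hu, hv, hk⟩ := hp
    have huM := mem_powerset.1 (hG hu)
    have hvM : Disjoint v M := subset_compl_iff_disjoint_right.1 hv
    have h1 : (u ∪ v) ∩ M = u := by
      rw [union_inter_distrib_right, inter_eq_left.2 huM, disjoint_iff_inter_eq_empty.1 hvM,
        union_empty]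
    have h2 : (u ∪ v) \ M = v := by
      rw [union_sdiff_distrib, sdiff_eq_empty_iff_subset.2 huM, empty_union,
        sdiff_eq_self_of_disjoint hvM]
    simp [h1, h2, hu, hk]
  · intro y _
    ext a
    simp
    tauto
  · rintro ⟨u, v⟩ hp
    simp only [coe_product, Set.mem_prod, mem_coe, mem_powersetCard] at hp
    obtain ⟨hu, hv, hk⟩ := hp
    have huM := mem_powerset.1 (hG hu)
    have hvM : Disjoint v M := subset_compl_iff_disjoint_right.1 hv
    have h1 : (u ∪ v) ∩ M = u := by
      rw [union_inter_distrib_right, inter_eq_left.2 huM, disjoint_iff_inter_eq_empty.1 hvM,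
        union_empty]
    have h2 : (u ∪ v) \ M = v := by
      rw [union_sdiff_distrib, sdiff_eq_empty_iff_subset.2 huM, empty_union,
        sdiff_eq_self_of_disjoint hvM]
    simp [h1, h2]

/-- A set is determined by its parts inside and outside `M`. In the applications `#M` is bounded
independently of `n`, so the factor is a constant. -/
theorem card_filter_card_sdiff_le [Fintype α] (M : Finset α) (k : ℕ) :
    #{y : Finset α | #(y \ M) ≤ k} ≤ 2 ^ #M * ballVolume (Fintype.card α) k := by
  rw [← card_filter_card_le, ← card_powerset, ← card_product]
  refine card_le_card_of_injOn (fun y => (y ∩ M, y \ M)) ?_ ?_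
  · intro y hy
    simp at hy
    simp [hy]
  · intro y _ z _ hyz
    simp only [Prod.mk.injEq] at hyz
    rw [← sup_inf_sdiff y M, ← sup_inf_sdiff z M]
    exact congrArg₂ _ hyz.1 hyz.2

/-- The number of subsets of a disjoint union with prescribed families of traces. -/
theorem card_filter_traces (T : Finset (Finset α))
    (hT : (T : Set (Finset α)).PairwiseDisjoint id) (F : Finset α → Finset (Finset α))
    (hF : ∀ A ∈ T, F A ⊆ A.powerset) :
    #{u ∈ (T.biUnion id).powerset | ∀ A ∈ T, u ∩ A ∈ F A} = ∏ A ∈ T, #(F A) := by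
  have key : ∀ (f : ∀ A ∈ T, Finset α), (∀ A (hA : A ∈ T), f A hA ⊆ A) →
      ∀ A (hA : A ∈ T), (T.attach.biUnion fun B => f B.1 B.2) ∩ A = f A hA := by
    intro f hf A hA
    ext a
    simp only [mem_inter, mem_biUnion, mem_attach, true_and, Subtype.exists]
    constructor
    · rintro ⟨⟨B, hB, haB⟩, haA⟩
      obtain rfl : B = A := by
        by_contra hne
        exact disjoint_left.1 (hT hB hA hne) (hf B hB haB) haA
      exact haB
    · intro ha
      exact ⟨⟨A, hA, ha⟩, hf A hA ha⟩
  rw [← card_pi]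
  refine card_nbij' (fun u A _ => u ∩ A) (fun f => T.attach.biUnion fun B => f B.1 B.2) ?_ ?_ ?_ ?_
  · intro u hu
    simp at hu
    simpa using hu.2
  · intro f hf
    have hf' : ∀ A (hA : A ∈ T), f A hA ∈ F A := by simpa using hf
    have hf'' : ∀ A (hA : A ∈ T), f A hA ⊆ A := fun A hA => mem_powerset.1 (hF A hA (hf' A hA))
    simp only [coe_filter, mem_powerset, Set.mem_ofPred_eq]
    refine ⟨?_, fun A hA => by rw [key f hf'' A hA]; exact hf' A hA⟩
    intro a ha
    simp only [mem_biUnion, mem_attach, true_and, Subtype.exists] at ha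
    obtain ⟨B, hB, haB⟩ := ha
    exact mem_biUnion.2 ⟨B, hB, hf'' B hB haB⟩
  · intro u hu
    simp at hu
    ext a
    simp only [mem_biUnion, mem_attach, true_and, Subtype.exists, mem_inter]
    constructor
    · rintro ⟨B, hB, ha, _⟩
      exact ha
    · intro ha
      obtain ⟨B, hB, haB⟩ := mem_biUnion.1 (hu.1 ha)
      exact ⟨B, hB, ha, haB⟩
  · intro f hf
    have hf' : ∀ A (hA : A ∈ T), f A hA ∈ F A := by simpa using hf
    have hf'' : ∀ A (hA : A ∈ T), f A hA ⊆ A := fun A hA => mem_powerset.1 (hF A hA (hf' A hA))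
    funext A hA
    exact key f hf'' A hA

theorem card_eq_sum_card_inter_add (T : Finset (Finset α))
    (hT : (T : Set (Finset α)).PairwiseDisjoint id) (y : Finset α) :
    #y = ∑ A ∈ T, #(y ∩ A) + #(y \ T.biUnion id) := by
  rw [← card_biUnion, ← inter_biUnion]
  · exact (card_inter_add_card_sdiff y (T.biUnion id)).symm
  · intro A hA B hB hne
    exact (hT hA hB hne).mono inter_subset_right inter_subset_right

theorem card_symmDiff_add (y A : Finset α) : #(y ∆ A) + 2 * #(y ∩ A) = #y + #A := by
  have h1 : #(y ∆ A) = #(y \ A) + #(A \ y) := by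
    rw [symmDiff_def, sup_eq_union, card_union_of_disjoint disjoint_sdiff_sdiff]
  have h2 := card_sdiff_add_card_inter y A
  have h3 := card_sdiff_add_card_inter A y
  rw [inter_comm] at h3
  omega

theorem card_symmDiff_eq_sdiff_add (y A M : Finset α) (hA : A ⊆ M) :
    #(y ∆ A) = #(y \ M) + #((y ∩ M) ∆ A) := by
  rw [← card_union_of_disjoint]
  · congr 1
    ext a
    have := @hA a
    simp only [mem_symmDiff, mem_union, mem_sdiff, mem_inter]
    tauto
  · rw [disjoint_left]
    intro a ha ha'
    have := @hA a
    simp only [mem_symmDiff, mem_sdiff, mem_inter] at ha ha'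
    tauto

/-- The members of a code in the ball of radius `e + 1` about `∅` are disjoint, and at most one of
them has a size other than `e + 1`, which then is `e`. -/
theorem disjoint_of_card_le {e : ℕ} {T : Finset (Finset α)}
    (hd : ∀ A ∈ T, ∀ B ∈ T, A ≠ B → 2 * e + 1 ≤ #(A ∆ B)) (hc : ∀ A ∈ T, #A ≤ e + 1)
    (hT2 : 2 ≤ #T) :
    (T : Set (Finset α)).PairwiseDisjoint id ∧
      ∃ P ∈ T, (#P = e ∨ #P = e + 1) ∧ ∀ A ∈ T, A ≠ P → #A = e + 1 := by
  -- The sizes sum to at most `2e + 2`, and each common point lowers the distance by 2, so a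
  -- distance of `2e + 1` leaves no room for one.
  have key : ∀ A ∈ T, ∀ B ∈ T, A ≠ B → #(A ∩ B) = 0 ∧ 2 * e + 1 ≤ #A + #B := by
    intro A hA B hB hne
    have h1 := hd A hA B hB hne
    have h2 := card_symmDiff_add A B
    have h3 := hc A hA
    have h4 := hc B hB
    omega
  refine ⟨fun A hA B hB hne => ?_, ?_⟩
  · exact disjoint_iff_inter_eq_empty.2 (card_eq_zero.1 (key A hA B hB hne).1)
  · obtain ⟨P, hP, hmin⟩ := exists_min_image T (fun A => #A) (card_pos.1 (by omega))
    refine ⟨P, hP, ?_, ?_⟩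
    · obtain ⟨Q, hQ, hQP⟩ := exists_mem_ne (show 1 < #T by omega) P
      have h1 := key Q hQ P hP hQP
      have h2 := hc Q hQ
      have h3 := hc P hP
      omega
    · intro A hA hne
      have h1 := key A hA P hP hne
      have h2 := hmin A hA
      have h3 := hc A hA
      omega

/-- The empty trace allowed for a member of size `e` makes up for its missing point, so the
exceptional member does not change the leading coefficient. -/
theorem card_traces {e : ℕ} (A : Finset α) (hA : #A = e ∨ #A = e + 1) :
    #{u ∈ A.powerset | #u = 1 ∨ (#A = e ∧ #u = 0)} = e + 1 := by
  have h1 : #{u ∈ A.powerset | #u = 1} = #A := by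
    rw [← powersetCard_eq_filter, card_powersetCard, Nat.choose_one_right]
  rcases hA with hA | hA
  · rw [filter_or, card_union_of_disjoint, h1, hA]
    · congr 1
      rw [card_eq_one]
      refine ⟨∅, ?_⟩
      ext u
      simp only [mem_filter, mem_powerset, true_and, card_eq_zero, mem_singleton]
      constructor
      · exact fun h => h.2
      · rintro rfl
        simp
    · rw [disjoint_filter]
      intro u _ h
      omega
  · rw [← hA]
    refine Eq.trans ?_ h1
    congr 1
    ext u
    simp only [mem_filter]
    have : ¬ #A = e := by omega
    tauto

end Counting

/-- The sets within distance `t` of all members of `T`. -/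
def commonBall {α : Type*} [Fintype α] [DecidableEq α] (t : ℕ) (T : Finset (Finset α)) :
    Finset (Finset α) :=
  Finset.univ.filter fun y => ∀ A ∈ T, #(y ∆ A) ≤ t

/-! ### Upper bounds for the common ball -/

section Upper

variable {α : Type*} [Fintype α] [DecidableEq α]

theorem mem_commonBall {t : ℕ} {T : Finset (Finset α)} {y : Finset α} :
    y ∈ commonBall t T ↔ ∀ A ∈ T, #(y ∆ A) ≤ t := by
  simp [commonBall]

theorem card_commonBall_translate (t : ℕ) (T : Finset (Finset α)) (u : Finset α) :
    #(commonBall t (T.image (u ∆ ·))) = #(commonBall t T) := by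
  refine card_nbij' (u ∆ ·) (u ∆ ·) ?_ ?_ ?_ ?_
  · intro y hy
    rw [mem_coe, mem_commonBall] at hy ⊢
    intro A hA
    have := hy _ (mem_image_of_mem _ hA)
    rwa [← symmDiff_assoc, symmDiff_comm y u] at this
  · intro y hy
    rw [mem_coe, mem_commonBall] at hy ⊢
    intro A hA
    obtain ⟨B, hB, rfl⟩ := mem_image.1 hA
    dsimp only
    rw [symmDiff_comm u y, symmDiff_assoc, symmDiff_symmDiff_cancel_left]
    exact hy B hB
  · intro y _
    simp
  · intro y _
    simp

/-- The trace of a word of weight at least `ℓ` in the common ball. -/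
theorem trace_dichotomy {e ℓ : ℕ} {T : Finset (Finset α)} (hT3 : 3 ≤ #T)
    (hT : (T : Set (Finset α)).PairwiseDisjoint id) {P : Finset α} (hP : P ∈ T)
    (hPe : #P = e ∨ #P = e + 1) (hTe : ∀ A ∈ T, A ≠ P → #A = e + 1)
    {y : Finset α} (hy : y ∈ commonBall (e + ℓ) T) (hyl : ℓ ≤ #y) :
    #(y \ T.biUnion id) + #T ≤ ℓ ∨
      (#(y \ T.biUnion id) + #T = ℓ + 1 ∧
        ∀ A ∈ T, #(y ∩ A) = 1 ∨ (#A = e ∧ #(y ∩ A) = 0)) := by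
  rw [mem_commonBall] at hy
  have hw := card_eq_sum_card_inter_add T hT y
  have hA : ∀ A ∈ T, A ≠ P → #y + 1 ≤ ℓ + 2 * #(y ∩ A) := by
    intro A hA hne
    have h1 := hy A hA
    have h2 := card_symmDiff_add y A
    have h3 := hTe A hA hne
    omega
  have hPy : #y + #P ≤ e + ℓ + 2 * #(y ∩ P) := by
    have h1 := hy P hP
    have h2 := card_symmDiff_add y P
    omega
  have hsum : #(y ∩ P) + ∑ A ∈ T.erase P, #(y ∩ A) = ∑ A ∈ T, #(y ∩ A) :=
    add_sum_erase T (fun A => #(y ∩ A)) hP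
  have hcard : #(T.erase P) + 1 = #T := card_erase_add_one hP
  have hone : ∀ A ∈ T.erase P, 1 ≤ #(y ∩ A) := by
    intro A hA'
    have := hA A (mem_of_mem_erase hA') (ne_of_mem_erase hA')
    omega
  by_cases h2 : #y < ℓ + 2
  · by_cases hall : ∀ A ∈ T.erase P, #(y ∩ A) = 1
    · have hs : ∑ A ∈ T.erase P, #(y ∩ A) = #(T.erase P) := by
        rw [sum_congr rfl hall, sum_const, smul_eq_mul, mul_one]
      by_cases h0 : #(y \ T.biUnion id) + #T ≤ ℓ
      · exact Or.inl h0
      · refine Or.inr ⟨by omega, fun A hAT => ?_⟩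
        by_cases hAP : A = P
        · subst hAP
          omega
        · exact Or.inl (hall A (mem_erase.2 ⟨hAP, hAT⟩))
    · left
      push Not at hall
      obtain ⟨B, hB, hB1⟩ := hall
      have hlt : ∑ A ∈ T.erase P, 1 < ∑ A ∈ T.erase P, #(y ∩ A) :=
        sum_lt_sum hone ⟨B, hB, lt_of_le_of_ne (hone B hB) (Ne.symm hB1)⟩
      rw [sum_const, smul_eq_mul, mul_one] at hlt
      omega
  -- For heavy `y`, the intersections with `P`, `Q` and `R` together grow like `3(#y - ℓ)/2`, faster
  -- than `#y`, which keeps the outside part small. Three members are needed here.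
  · left
    obtain ⟨Q, hQ, R, hR, hQR⟩ := one_lt_card.1 (show 1 < #(T.erase P) by omega)
    have hR' : R ∈ (T.erase P).erase Q := mem_erase.2 ⟨hQR.symm, hR⟩
    have s1 : #(y ∩ Q) + ∑ A ∈ (T.erase P).erase Q, #(y ∩ A) = ∑ A ∈ T.erase P, #(y ∩ A) :=
      add_sum_erase _ (fun A => #(y ∩ A)) hQ
    have s2 : #(y ∩ R) + ∑ A ∈ ((T.erase P).erase Q).erase R, #(y ∩ A) =
        ∑ A ∈ (T.erase P).erase Q, #(y ∩ A) :=
      add_sum_erase _ (fun A => #(y ∩ A)) hR'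
    have c1 := card_erase_add_one hQ
    have c2 := card_erase_add_one hR'
    have s3 : ∑ A ∈ ((T.erase P).erase Q).erase R, 1 ≤
        ∑ A ∈ ((T.erase P).erase Q).erase R, #(y ∩ A) :=
      sum_le_sum fun A hA' => hone A (mem_of_mem_erase (mem_of_mem_erase hA'))
    rw [sum_const, smul_eq_mul, mul_one] at s3
    have q := hA Q (mem_of_mem_erase hQ) (ne_of_mem_erase hQ)
    have r := hA R (mem_of_mem_erase hR) (ne_of_mem_erase hR)
    omega

/-- The common ball of words that have a common centre at distance at most `e + 1`. -/
theorem card_commonBall_le_of_centre {e ℓ h : ℕ} (h3 : 3 ≤ h) (hℓ : h ≤ ℓ)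
    {T : Finset (Finset α)} (hTh : #T = h)
    (hd : ∀ A ∈ T, ∀ B ∈ T, A ≠ B → 2 * e + 1 ≤ #(A ∆ B)) (hc : ∀ A ∈ T, #A ≤ e + 1) :
    #(commonBall (e + ℓ) T) ≤ ballVolume (Fintype.card α) (ℓ - 1) +
      (e + 1) ^ h * (Fintype.card α - h * (e + 1) + 1).choose (ℓ + 1 - h) +
      2 ^ (h * (e + 1)) * ballVolume (Fintype.card α) (ℓ - h) := by
  obtain ⟨hT, P, hP, hPe, hTe⟩ := disjoint_of_card_le hd hc (by omega)
  set M := T.biUnion id with hM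
  obtain ⟨F, hF⟩ : ∃ F : Finset α → Finset (Finset α),
      ∀ A, F A = A.powerset.filter fun u => #u = 1 ∨ (#A = e ∧ #u = 0) := ⟨_, fun _ => rfl⟩
  set G : Finset (Finset α) := {u ∈ M.powerset | ∀ A ∈ T, u ∩ A ∈ F A} with hG
  have hMcard : #M = ∑ A ∈ T, #A := card_biUnion hT
  have hsum : #P + ∑ A ∈ T.erase P, #A = ∑ A ∈ T, #A := add_sum_erase T (fun A => #A) hP
  have hsum' : ∑ A ∈ T.erase P, #A = (h - 1) * (e + 1) := by
    rw [sum_congr rfl fun A hA => hTe A (mem_of_mem_erase hA) (ne_of_mem_erase hA), sum_const,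
      card_erase_of_mem hP, hTh, smul_eq_mul]
  have hh : h * (e + 1) = (h - 1) * (e + 1) + (e + 1) := by
    obtain ⟨k, rfl⟩ : ∃ k, h = k + 1 := ⟨h - 1, by omega⟩
    simp [Nat.succ_mul]
  have hGcard : #G = (e + 1) ^ h := by
    rw [hG, hM, ← hTh]
    have htr := card_filter_traces T hT F fun A _ => by rw [hF]; exact filter_subset _ _
    refine Eq.trans (by congr!) (htr.trans ?_)
    refine prod_eq_pow_card fun A hA => ?_
    rw [hF]
    refine card_traces A ?_
    by_cases hAP : A = P
    · rw [hAP]; exact hPe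
    · exact Or.inr (hTe A hA hAP)
  have hsub : commonBall (e + ℓ) T ⊆ (univ.filter (fun y => #y ≤ ℓ - 1) ∪
      univ.filter fun y => y ∩ M ∈ G ∧ #(y \ M) = ℓ + 1 - h) ∪
      univ.filter fun y => #(y \ M) ≤ ℓ - h := by
    intro y hy
    simp only [mem_union, mem_filter, mem_univ, true_and]
    by_cases hyl : #y ≤ ℓ - 1
    · exact Or.inl (Or.inl hyl)
    · rcases trace_dichotomy (by omega) hT hP hPe hTe hy (by omega) with h1 | ⟨h1, h2⟩ <;>
        rw [← hM, hTh] at h1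
      · right
        omega
      · left
        right
        refine ⟨?_, by omega⟩
        rw [hG, mem_filter]
        refine ⟨mem_powerset.2 inter_subset_right, fun A hA => ?_⟩
        have hAM : A ⊆ M := subset_biUnion_of_mem id hA
        rw [hF, mem_filter, inter_assoc, inter_eq_right.2 hAM]
        exact ⟨mem_powerset.2 inter_subset_right, h2 A hA⟩
  refine (card_le_card hsub).trans ((card_union_le _ _).trans ?_)
  refine add_le_add ((card_union_le _ _).trans (add_le_add (card_filter_card_le _).le ?_)) ?_
  · rw [card_filter_inter_mem M G (filter_subset _ _), hGcard]
    -- `#M` is `h * (e + 1)` or one less, according to the size of `P`; hence the `+ 1` in the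
    -- bound.
    exact Nat.mul_le_mul_left _ (Nat.choose_le_choose _ (by omega))
  · refine (card_filter_card_sdiff_le M _).trans (Nat.mul_le_mul_right _ ?_)
    exact Nat.pow_le_pow_right (by norm_num) (by omega)

/-- The common ball of words that have no common centre at distance at most `e + 1`. -/
theorem card_commonBall_le_of_no_centre {e ℓ h : ℕ} (h3 : 3 ≤ h) (hℓ : h ≤ ℓ)
    {T : Finset (Finset α)} (hTh : #T = h) (hc : ∀ u : Finset α, ∃ A ∈ T, e + 2 ≤ #(u ∆ A))
    (h0 : ∅ ∈ T) :
    #(commonBall (e + ℓ) T) ≤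
      2 ^ (h * (2 * (e + ℓ))) * ballVolume (Fintype.card α) (ℓ - 2) := by
  rcases (commonBall (e + ℓ) T).eq_empty_or_nonempty with hI | ⟨z, hz⟩
  · simp [hI]
  rw [mem_commonBall] at hz
  -- Since `∅ ∈ T`, the common point `z` is small, and so is every member.
  have hM : #(T.biUnion id) ≤ h * (2 * (e + ℓ)) := by
    rw [← hTh]
    refine card_biUnion_le_card_mul _ _ _ fun A hA => ?_
    have h1 := hz A hA
    have h2 := hz ∅ h0
    have h4 : #A ≤ #(z ∆ A) + #z := by
      have := card_symmDiff_add z A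
      have := card_le_card (inter_subset_left : z ∩ A ⊆ z)
      omega
    have h5 : z ∆ (∅ : Finset α) = z := symmDiff_bot z
    rw [h5] at h2
    simp only [id]
    omega
  refine (card_le_card ?_).trans ((card_filter_card_sdiff_le (T.biUnion id) (ℓ - 2)).trans
    (Nat.mul_le_mul_right _ (Nat.pow_le_pow_right (by norm_num) hM)))
  intro y hy
  rw [mem_commonBall] at hy
  -- The trace of `y` is tested as a centre: its distance from `A` uses up `e + 2` of the radius.
  obtain ⟨A, hA, hlarge⟩ := hc (y ∩ T.biUnion id)
  have h1 := card_symmDiff_eq_sdiff_add y A _ (subset_biUnion_of_mem id hA)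
  have h2 := hy A hA
  simp only [mem_filter, mem_univ, true_and]
  omega

/-- Translation preserves the common ball, so a centre, if there is one, may be moved to `∅`;
otherwise a member is. -/
theorem card_commonBall_le {e ℓ h : ℕ} (h3 : 3 ≤ h) (hℓ : h ≤ ℓ)
    {T : Finset (Finset α)} (hTh : #T = h)
    (hd : ∀ A ∈ T, ∀ B ∈ T, A ≠ B → 2 * e + 1 ≤ #(A ∆ B)) :
    #(commonBall (e + ℓ) T) ≤ ballVolume (Fintype.card α) (ℓ - 1) +
      (e + 1) ^ h * (Fintype.card α - h * (e + 1) + 1).choose (ℓ + 1 - h) +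
      2 ^ (h * (e + 1)) * ballVolume (Fintype.card α) (ℓ - h) ∨
    #(commonBall (e + ℓ) T) ≤
      2 ^ (h * (2 * (e + ℓ))) * ballVolume (Fintype.card α) (ℓ - 2) := by
  have hinj : ∀ u : Finset α, Function.Injective (u ∆ ·) := fun u => symmDiff_right_injective u
  by_cases hc : ∃ u : Finset α, ∀ A ∈ T, #(u ∆ A) ≤ e + 1
  · left
    obtain ⟨u, hu⟩ := hc
    rw [← card_commonBall_translate _ T u]
    refine card_commonBall_le_of_centre h3 hℓ (by rw [card_image_of_injective _ (hinj u), hTh])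
      ?_ ?_
    · simp only [mem_image, forall_exists_index, and_imp, forall_apply_eq_imp_iff₂]
      intro A hA B hB hne
      rw [symmDiff_comm u A, symmDiff_assoc, symmDiff_symmDiff_cancel_left]
      exact hd A hA B hB fun h => hne (by rw [h])
    · simpa using hu
  · right
    push Not at hc
    obtain ⟨A₀, hA₀⟩ := card_pos.1 (show 0 < #T by omega)
    rw [← card_commonBall_translate _ T A₀]
    refine card_commonBall_le_of_no_centre h3 hℓ
      (by rw [card_image_of_injective _ (hinj A₀), hTh]) ?_ ?_
    · intro u
      obtain ⟨A, hA, hlt⟩ := hc (u ∆ A₀)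
      refine ⟨A₀ ∆ A, mem_image_of_mem _ hA, ?_⟩
      rw [← symmDiff_assoc]
      exact hlt
    · exact mem_image.2 ⟨A₀, hA₀, symmDiff_self A₀⟩

end Upper

/-! ### Orders of growth and a uniform upper bound -/

theorem ballVolume_le {n : ℕ} (hn : 1 ≤ n) (k : ℕ) : ballVolume n k ≤ (k + 1) * n ^ k := by
  rw [ballVolume]
  refine (sum_le_card_nsmul _ _ (n ^ k) fun i hi => ?_).trans (by simp)
  have := mem_range.1 hi
  exact (Nat.choose_le_pow n i).trans (Nat.pow_le_pow_right hn (by omega))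

/-- All `k` factors of the descending factorial of `n - m` are at least `n / 2`. -/
theorem pow_le_mul_choose_sub {n m k : ℕ} (hn : 2 * (m + k) ≤ n) :
    n ^ k ≤ 2 ^ k * k.factorial * (n - m).choose k := by
  rw [mul_assoc, ← Nat.descFactorial_eq_factorial_mul_choose]
  refine le_trans ?_ (Nat.mul_le_mul_left _ (Nat.pow_sub_le_descFactorial (n - m) k))
  rw [← mul_pow]
  exact Nat.pow_le_pow_left (by omega) k

theorem exists_forall_mul_ballVolume_le (c k : ℕ) :
    ∃ n₀, ∀ n, n₀ ≤ n → c * ballVolume n k ≤ ballVolume n (k + 1) := by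
  set q := 2 ^ (k + 1) * (k + 1).factorial with hq
  refine ⟨c * (k + 1) * q + 2 * (k + 1), fun n hn => ?_⟩
  have hq0 : 0 < q := by positivity
  have h1 : n ^ (k + 1) ≤ q * n.choose (k + 1) := by
    have := pow_le_mul_choose_sub (n := n) (m := 0) (k := k + 1) (by omega)
    simpa using this
  have h2 : n.choose (k + 1) ≤ ballVolume n (k + 1) :=
    single_le_sum (f := fun i => n.choose i) (fun _ _ => Nat.zero_le _) (mem_range.2 (by omega))
  have h3 := ballVolume_le (show 1 ≤ n by omega) k
  refine Nat.le_of_mul_le_mul_left ?_ hq0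
  calc q * (c * ballVolume n k) ≤ q * (c * ((k + 1) * n ^ k)) := by gcongr
    _ = c * (k + 1) * q * n ^ k := by ring
    _ ≤ n * n ^ k := Nat.mul_le_mul_right _ (by omega)
    _ = n ^ (k + 1) := by ring
    _ ≤ q * ballVolume n (k + 1) := h1.trans (Nat.mul_le_mul_left _ h2)

theorem exists_card_commonBall_le {e ℓ h : ℕ} (h3 : 3 ≤ h) (hℓ : h ≤ ℓ) :
    ∃ K : ℕ, ∀ n, 1 ≤ n → ∀ T : Finset (Finset (Fin n)), #T = h →
      (∀ A ∈ T, ∀ B ∈ T, A ≠ B → 2 * e + 1 ≤ #(A ∆ B)) →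
      #(commonBall (e + ℓ) T) ≤ ballVolume n (ℓ - 1) +
        (e + 1) ^ h * (n - h * (e + 1)).choose (ℓ + 1 - h) + K * n ^ (ℓ - h) := by
  obtain ⟨n₀, hn₀⟩ := exists_forall_mul_ballVolume_le (2 ^ (h * (2 * (e + ℓ)))) (ℓ - 2)
  -- `2 ^ n₀` covers all lengths below `n₀`, where the bound without a centre need not fall below
  -- `V(n, ℓ - 1)`. The rest comes from the bound with a centre.
  refine ⟨2 ^ n₀ + ((e + 1) ^ h + 2 ^ (h * (e + 1)) * (ℓ - h + 1)), fun n hn T hT hd => ?_⟩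
  have hpow : 1 ≤ n ^ (ℓ - h) := Nat.one_le_pow _ _ hn
  rcases card_commonBall_le h3 hℓ hT hd with hI | hI <;> rw [Fintype.card_fin] at hI
  · have h1 : (n - h * (e + 1) + 1).choose (ℓ + 1 - h) ≤
        n ^ (ℓ - h) + (n - h * (e + 1)).choose (ℓ + 1 - h) := by
      -- Pascal's rule: removing the `+ 1` costs one binomial coefficient of the order of the error
      -- term.
      rw [show ℓ + 1 - h = ℓ - h + 1 by omega, Nat.choose_succ_succ]
      gcongr
      exact (Nat.choose_le_pow _ _).trans (Nat.pow_le_pow_left (by omega) _)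
    have h2 := ballVolume_le hn (ℓ - h)
    calc _ ≤ _ := hI
      _ ≤ ballVolume n (ℓ - 1) +
          (e + 1) ^ h * (n ^ (ℓ - h) + (n - h * (e + 1)).choose (ℓ + 1 - h)) +
          2 ^ (h * (e + 1)) * ((ℓ - h + 1) * n ^ (ℓ - h)) := by gcongr
      _ = ballVolume n (ℓ - 1) + (e + 1) ^ h * (n - h * (e + 1)).choose (ℓ + 1 - h) +
          ((e + 1) ^ h + 2 ^ (h * (e + 1)) * (ℓ - h + 1)) * n ^ (ℓ - h) := by ring
      _ ≤ _ := by
        refine Nat.add_le_add_left (Nat.mul_le_mul_right _ (Nat.le_add_left _ _)) _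
  · by_cases hn' : n₀ ≤ n
    · have := hn₀ n hn'
      rw [show ℓ - 2 + 1 = ℓ - 1 by omega] at this
      exact (hI.trans this).trans ((Nat.le_add_right _ _).trans (Nat.le_add_right _ _))
    · calc #(commonBall (e + ℓ) T) ≤ 2 ^ n := by
            simpa using card_le_univ (commonBall (e + ℓ) T)
        _ ≤ 2 ^ n₀ * 1 := by
            rw [mul_one]
            exact Nat.pow_le_pow_right (by norm_num) (by omega)
        _ ≤ (2 ^ n₀ + ((e + 1) ^ h + 2 ^ (h * (e + 1)) * (ℓ - h + 1))) * n ^ (ℓ - h) :=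
            Nat.mul_le_mul (Nat.le_add_right _ _) hpow
        _ ≤ _ := Nat.le_add_left _ _

/-! ### Lower bound from disjoint sets -/

/-- The common ball of disjoint words of weight `e + 1`. -/
theorem le_card_commonBall {α : Type*} [Fintype α] [DecidableEq α] {e ℓ h : ℕ} (h1 : 1 ≤ h)
    (hℓ : h ≤ ℓ) {T : Finset (Finset α)} (hTh : #T = h)
    (hT : (T : Set (Finset α)).PairwiseDisjoint id) (hTe : ∀ A ∈ T, #A = e + 1) :
    ballVolume (Fintype.card α) (ℓ - 1) +
      (e + 1) ^ h * (Fintype.card α - h * (e + 1)).choose (ℓ + 1 - h) +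
      (e + 1) ^ h * (Fintype.card α - h * (e + 1)).choose (ℓ - h) ≤
      #(commonBall (e + ℓ) T) := by
  set M := T.biUnion id with hM
  set G : Finset (Finset α) :=
    {u ∈ M.powerset | ∀ A ∈ T, u ∩ A ∈ A.powersetCard 1} with hG
  have hMcard : #M = h * (e + 1) := by
    rw [hM, card_biUnion hT, ← hTh, ← smul_eq_mul, ← sum_const]
    exact sum_congr rfl hTe
  have hGcard : #G = (e + 1) ^ h := by
    rw [hG, hM, ← hTh]
    have htr := card_filter_traces T hT (fun A => A.powersetCard 1)
      fun A _ u hu => mem_powerset.2 (mem_powersetCard.1 hu).1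
    refine Eq.trans (by congr!) (htr.trans ?_)
    exact prod_eq_pow_card fun A hA => by rw [card_powersetCard, Nat.choose_one_right, hTe A hA]
  have htrace : ∀ y : Finset α, y ∩ M ∈ G → (∀ A ∈ T, #(y ∩ A) = 1) ∧ #y = h + #(y \ M) := by
    intro y hy
    have hone : ∀ A ∈ T, #(y ∩ A) = 1 := by
      intro A hA
      have hAM : A ⊆ M := subset_biUnion_of_mem id hA
      have := (mem_powersetCard.1 ((mem_filter.1 hy).2 A hA)).2
      rwa [inter_assoc, inter_eq_right.2 hAM] at this
    refine ⟨hone, ?_⟩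
    rw [card_eq_sum_card_inter_add T hT y, sum_congr rfl hone, sum_const, hTh, smul_eq_mul, mul_one]
  have hcount : ∀ s, #{y : Finset α | y ∩ M ∈ G ∧ #(y \ M) = s} =
      (e + 1) ^ h * (Fintype.card α - h * (e + 1)).choose s := by
    intro s
    rw [card_filter_inter_mem M G (filter_subset _ _), hGcard, hMcard]
  -- The three families have sizes at most `ℓ - 1`, exactly `ℓ + 1` and exactly `ℓ`, so they are
  -- disjoint.
  rw [← card_filter_card_le, ← hcount, ← hcount, ← card_union_of_disjoint, ← card_union_of_disjoint]
  · refine card_le_card fun y hy => mem_commonBall.2 fun A hA => ?_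
    have hs := card_symmDiff_add y A
    have hAe := hTe A hA
    simp only [mem_union, mem_filter, mem_univ, true_and] at hy
    rcases hy with (hy | ⟨hy, hys⟩) | ⟨hy, hys⟩
    · omega
    all_goals
      obtain ⟨hone, hw⟩ := htrace y hy
      have := hone A hA
      omega
  · rw [disjoint_left]
    intro y hy hy'
    simp only [mem_union, mem_filter, mem_univ, true_and] at hy hy'
    have := (htrace y hy'.1).2
    omega
  · rw [disjoint_filter]
    intro y _ hy hy'
    have := (htrace y hy'.1).2
    omega

theorem exists_disjoint_sets {e h n : ℕ} (hn : h * (e + 1) ≤ n) :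
    ∃ T : Finset (Finset (Fin n)), #T = h ∧ (T : Set (Finset (Fin n))).PairwiseDisjoint id ∧
      ∀ A ∈ T, #A = e + 1 := by
  obtain ⟨g⟩ : Nonempty (Fin h × Fin (e + 1) ↪ Fin n) :=
    Function.Embedding.nonempty_of_card_le (by simpa using hn)
  set A : Fin h → Finset (Fin n) := fun i => univ.image fun r => g (i, r) with hA
  have hdisj : ∀ i j, i ≠ j → Disjoint (A i) (A j) := by
    intro i j hij
    rw [disjoint_left]
    intro a ha ha'
    obtain ⟨r, _, rfl⟩ := mem_image.1 ha
    obtain ⟨s, _, hs⟩ := mem_image.1 ha'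
    exact hij (congrArg Prod.fst (g.injective hs)).symm
  have hcard : ∀ i, #(A i) = e + 1 := by
    intro i
    rw [hA, card_image_of_injective _ fun r s hrs => congrArg Prod.snd (g.injective hrs)]
    simp
  have hinj : Function.Injective A := by
    intro i j hij
    by_contra hne
    have := hdisj i j hne
    rw [hij, disjoint_self, bot_eq_empty] at this
    have h1 := hcard j
    simp [this] at h1
  refine ⟨univ.image A, by rw [card_image_of_injective _ hinj]; simp, ?_, ?_⟩
  · intro B hB D hD hne
    simp only [coe_image, coe_univ, Set.image_univ, Set.mem_range] at hB hD
    obtain ⟨i, rfl⟩ := hB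
    obtain ⟨j, rfl⟩ := hD
    exact hdisj i j fun hij => hne (by rw [hij])
  · simpa using hcard

/-! ### From sets back to codes and decoders -/

/-- Words correspond to their supports. -/
def supportEquiv (n : ℕ) : Word n ≃ Finset (Fin n) where
  toFun x := univ.filter fun i => x i ≠ 0
  invFun s i := if i ∈ s then 1 else 0
  left_inv x := by
    funext i
    have : ∀ a : ZMod 2, (if a ≠ 0 then (1 : ZMod 2) else 0) = a := by decide
    simpa using this (x i)
  right_inv s := by
    ext i
    simp

theorem hammingDist_eq_card_symmDiff {n : ℕ} (x y : Word n) :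
    hammingDist x y = #(supportEquiv n x ∆ supportEquiv n y) := by
  rw [hammingDist]
  congr 1
  ext i
  have : ∀ a b : ZMod 2, a ≠ b ↔ (a ≠ 0 ∧ ¬ b ≠ 0) ∨ (b ≠ 0 ∧ ¬ a ≠ 0) := by decide
  simpa [supportEquiv, mem_symmDiff] using this (x i) (y i)

theorem mem_ball {n t : ℕ} {x y : Word n} : y ∈ ball t x ↔ hammingDist x y ≤ t := by
  simp [ball]

theorem IsErrorCorrecting.le_hammingDist {n e : ℕ} {C : Finset (Word n)}
    (hC : IsErrorCorrecting e C) {x y : Word n} (hx : x ∈ C) (hy : y ∈ C) (hxy : x ≠ y) :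
    2 * e + 1 ≤ hammingDist x y := by
  have h1 : minDist C ≤ hammingDist x y := Nat.sInf_le ⟨x, hx, y, hy, hxy, rfl⟩
  have h2 := hC.2
  -- Needed for `e = 0`, where the truncated subtraction in `h2` would allow a minimum distance of
  -- 0.
  have h3 : 0 < hammingDist x y := hammingDist_pos.2 hxy
  omega

theorem exists_commonBall_of_mem_channelCounts {n ℓ e h N : ℕ} (hN : N ∈ channelCounts n ℓ e h) :
    ∃ T : Finset (Finset (Fin n)), #T = h ∧
      (∀ A ∈ T, ∀ B ∈ T, A ≠ B → 2 * e + 1 ≤ #(A ∆ B)) ∧ N ≤ #(commonBall (e + ℓ) T) := by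
  obtain ⟨C, hC, Y, hY, hcard⟩ := hN
  obtain ⟨S, hS, hSh⟩ := exists_subset_card_eq hcard
  refine ⟨S.map (supportEquiv n).toEmbedding, by rw [card_map, hSh], ?_, ?_⟩
  · simp only [mem_map_equiv]
    intro A hA B hB hne
    have := hC.le_hammingDist (mem_filter.1 (hS hA)).1 (mem_filter.1 (hS hB)).1
      ((supportEquiv n).symm.injective.ne hne)
    simpa [hammingDist_eq_card_symmDiff] using this
  · have hYN : #Y = N := (mem_filter.1 hY).2.1
    rw [← hYN, ← card_map (supportEquiv n).toEmbedding]
    refine card_le_card fun y hy => mem_commonBall.2 fun A hA => ?_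
    rw [mem_map_equiv] at hy hA
    have := mem_ball.1 ((mem_filter.1 (hS hA)).2 _ hy)
    simpa [hammingDist_eq_card_symmDiff] using this

/-- `T` itself is the code: its minimum distance `2e + 2` still has correcting capability exactly
`e`. -/
theorem card_commonBall_mem_channelCounts {n ℓ e h : ℕ} (h2 : 2 ≤ h)
    {T : Finset (Finset (Fin n))} (hTh : #T = h)
    (hT : (T : Set (Finset (Fin n))).PairwiseDisjoint id) (hTe : ∀ A ∈ T, #A = e + 1) :
    #(commonBall (e + ℓ) T) ∈ channelCounts n ℓ e h := by
  have hT2 : 1 < #T := by omega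
  obtain ⟨P, hP, Q, hQ, hPQ⟩ := one_lt_card.1 hT2
  have hdist : ∀ A ∈ T, ∀ B ∈ T, A ≠ B → #(A ∆ B) = 2 * e + 2 := by
    intro A hA B hB hne
    have h1 := card_symmDiff_add A B
    have h3 : #(A ∩ B) = 0 := card_eq_zero.2 (disjoint_iff_inter_eq_empty.1 (hT hA hB hne))
    have h4 := hTe A hA
    have h5 := hTe B hB
    omega
  set C := T.map (supportEquiv n).symm.toEmbedding with hC
  set Y := (commonBall (e + ℓ) T).map (supportEquiv n).symm.toEmbedding with hY
  have hmemC : ∀ c, c ∈ C ↔ supportEquiv n c ∈ T := fun c => by simp [hC, mem_map_equiv]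
  have hmemY : ∀ y, y ∈ Y ↔ supportEquiv n y ∈ commonBall (e + ℓ) T :=
    fun y => by simp [hY, mem_map_equiv]
  have hclose : ∀ c ∈ C, ∀ y ∈ Y, hammingDist y c ≤ e + ℓ := by
    intro c hc y hy
    rw [hammingDist_eq_card_symmDiff]
    exact mem_commonBall.1 ((hmemY y).1 hy) _ ((hmemC c).1 hc)
  have hmin : minDist C = 2 * e + 2 := by
    have : {d | ∃ x ∈ C, ∃ y ∈ C, x ≠ y ∧ hammingDist x y = d} = {2 * e + 2} := by
      ext d
      constructor
      · rintro ⟨x, hx, y, hy, hne, rfl⟩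
        rw [hammingDist_eq_card_symmDiff]
        exact hdist _ ((hmemC x).1 hx) _ ((hmemC y).1 hy) ((supportEquiv n).injective.ne hne)
      · rintro rfl
        refine ⟨(supportEquiv n).symm P, (hmemC _).2 (by simpa), (supportEquiv n).symm Q,
          (hmemC _).2 (by simpa), (supportEquiv n).symm.injective.ne hPQ, ?_⟩
        rw [hammingDist_eq_card_symmDiff]
        simpa using hdist P hP Q hQ hPQ
    rw [minDist, this, csInf_singleton]
  refine ⟨C, ⟨?_, by omega⟩, Y, ?_, ?_⟩
  · rw [← one_lt_card_iff_nontrivial, hC, card_map]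
    exact hT2
  · refine mem_filter.2 ⟨mem_univ _, by rw [hY, card_map], (supportEquiv n).symm P,
      (hmemC _).2 (by simpa), fun y hy => mem_ball.2 ?_⟩
    rw [hammingDist_comm]
    exact hclose _ ((hmemC _).2 (by simpa)) y hy
  · have : candidates C (e + ℓ) Y = C :=
      filter_true_of_mem fun c hc y hy => mem_ball.2 (hclose c hc y hy)
    rw [this, hC, card_map, hTh]

theorem isGreatest_maxChannels {n ℓ e h : ℕ} (hne : (channelCounts n ℓ e h).Nonempty) :
    IsGreatest (channelCounts n ℓ e h) (maxChannels n ℓ e h) := by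
  -- The supremum of an empty or unbounded set of naturals is the default value 0, so both
  -- properties are needed.
  have hb : BddAbove (channelCounts n ℓ e h) := by
    refine ⟨Fintype.card (Word n), ?_⟩
    rintro N ⟨C, _, Y, hY, _⟩
    rw [← (mem_filter.1 hY).2.1]
    exact card_le_univ Y
  exact ⟨Nat.sSup_mem hne hb, fun N hN => le_csSup hb hN⟩

/-- The decoder returning `T(Y)` is successful, and a list of `h` words would make `N` a channel
count. -/
theorem listSize_le {n ℓ e h N : ℕ} (hN : N ∉ channelCounts n ℓ e h)
    {C : Finset (Word n)} (hC : IsErrorCorrecting e C) : listSize C (e + ℓ) N ≤ h - 1 := by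
  have hsucc : IsSuccessful C (e + ℓ) N (candidates C (e + ℓ)) := by
    intro x hx Y _ hYx
    refine mem_filter.2 ⟨hx, fun y hy => mem_ball.2 ?_⟩
    rw [hammingDist_comm]
    exact mem_ball.1 (hYx hy)
  have hle : listSize C (e + ℓ) N ≤ decoderListSize C (e + ℓ) N (candidates C (e + ℓ)) :=
    Nat.sInf_le ⟨_, hsucc, rfl⟩
  refine hle.trans (Finset.sup_le fun Y hY => ?_)
  by_contra hlt
  exact hN ⟨C, hC, Y, hY, by omega⟩

/-- This leaves room for `h` disjoint sets of size `e + 1` and keeps `n - h * (e + 1)` of order `n`.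
-/
theorem le_lengthBound {e ℓ b n : ℕ} (hℓ : 3 ≤ ℓ) (hb : max (3 * (e + ℓ)) (4 * e + 4) ≤ b)
    (hn : lengthBound e ℓ b ≤ n) : 2 * (ℓ * (e + 1) + ℓ) ≤ n := by
  obtain ⟨hb1, hb2⟩ := max_le_iff.1 hb
  have hb1' : 3 * ((e : ℤ) + ℓ) ≤ b := by exact_mod_cast hb1
  have hb2' : 4 * (e : ℤ) + 4 ≤ b := by exact_mod_cast hb2
  have hℓ' : (3 : ℤ) ≤ ℓ := by exact_mod_cast hℓ
  have he : (0 : ℤ) ≤ e := Int.natCast_nonneg e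
  rw [lengthBound] at hn
  set c : ℤ := (((b - 2 * e - 1).choose 2 : ℕ) : ℤ) with hc
  have hc0 : 0 ≤ c := Int.natCast_nonneg _
  -- From `b ≥ 4e + 4`, the term `e * b` absorbs `3e + 2e²`.
  have h1 : (b : ℤ) ≤ b - 3 * e - 2 * e ^ 2 + e * b + c := by nlinarith
  have h2 : ((e : ℤ) + 1) * b ≤
      b - e + (e + 1) * (b - 3 * e - 2 * e ^ 2 + e * b + c) := by nlinarith
  have h3 : (4 : ℤ) ≤ (ℓ - 1) ^ 2 := by nlinarith
  have h4 : 4 * (((e : ℤ) + 1) * b) ≤ n := by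
    have h5 : 4 * (((e : ℤ) + 1) * b) ≤ ((ℓ : ℤ) - 1) ^ 2 *
        (b - e + (e + 1) * (b - 3 * e - 2 * e ^ 2 + e * b + c)) :=
      mul_le_mul h3 h2 (by positivity) (by positivity)
    linarith
  have h5 : 2 * ((ℓ : ℤ) * (e + 1) + ℓ) ≤ n := by nlinarith
  exact_mod_cast h5

end SequenceReconstruction

/-! ### The main theorem -/

theorem mainTheorem5 (e ℓ h : ℕ) (hh : 3 ≤ h) (hℓ : h ≤ ℓ) :
    ∃ c₁ c₂ : ℝ, 0 < c₁ ∧ 0 < c₂ ∧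
      ∀ b n : ℕ, max (3 * (e + ℓ)) (4 * e + 4) ≤ b →
        SequenceReconstruction.lengthBound e ℓ b ≤ (n : ℤ) →
        IsGreatest (SequenceReconstruction.channelCounts n ℓ e h)
            (SequenceReconstruction.maxChannels n ℓ e h) ∧
        (∀ N : ℕ, SequenceReconstruction.maxChannels n ℓ e h + 1 ≤ N →
          ∀ C : Finset (SequenceReconstruction.Word n),
            SequenceReconstruction.IsErrorCorrecting e C →
            SequenceReconstruction.listSize C (e + ℓ) N ≤ h - 1) ∧
        c₁ * (n : ℝ) ^ (ℓ - h) ≤ SequenceReconstruction.remainder n ℓ e h ∧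
        SequenceReconstruction.remainder n ℓ e h ≤ c₂ * (n : ℝ) ^ (ℓ - h) := by
  open SequenceReconstruction in
  obtain ⟨K, hK⟩ := exists_card_commonBall_le (e := e) hh hℓ
  set q := 2 ^ (ℓ - h) * (ℓ - h).factorial with hq
  have hq0 : 0 < q := by positivity
  have hq0' : (0 : ℝ) < q := by exact_mod_cast hq0
  -- `q` is the constant of `pow_le_mul_choose_sub` for the binomial coefficient with lower index `ℓ
  -- - h`; the `+ 1` keeps `c₂` positive even if `K = 0`.
  refine ⟨1 / (q : ℝ), K + 1, by positivity, by positivity, fun b n hb hn => ?_⟩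
  have hn' := le_lengthBound (hh.trans hℓ) hb hn
  have hm : h * (e + 1) ≤ ℓ * (e + 1) := Nat.mul_le_mul_right _ hℓ
  obtain ⟨T, hTh, hT, hTe⟩ := exists_disjoint_sets (show h * (e + 1) ≤ n by omega)
  have hmem := card_commonBall_mem_channelCounts (ℓ := ℓ) (show 2 ≤ h by omega) hTh hT hTe
  have hmax := isGreatest_maxChannels ⟨_, hmem⟩
  refine ⟨hmax, fun N hN C hC => listSize_le (fun hN' => ?_) hC, ?_, ?_⟩
  · have := hmax.2 hN'
    omega
  · have h1 := (le_card_commonBall (show 1 ≤ h by omega) hℓ hTh hT hTe).trans (hmax.2 hmem)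
    rw [Fintype.card_fin] at h1
    have h2 : n ^ (ℓ - h) ≤ q * ((e + 1) ^ h * (n - h * (e + 1)).choose (ℓ - h)) :=
      (pow_le_mul_choose_sub (n := n) (m := h * (e + 1)) (k := ℓ - h) (by omega)).trans
        (Nat.mul_le_mul_left _ (Nat.le_mul_of_pos_left _ (by positivity)))
    have h1' : (ballVolume n (ℓ - 1) : ℝ) +
        ((e : ℝ) + 1) ^ h * ((n - h * (e + 1)).choose (ℓ + 1 - h) : ℝ) +
        ((e : ℝ) + 1) ^ h * ((n - h * (e + 1)).choose (ℓ - h) : ℝ) ≤ maxChannels n ℓ e h := by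
      exact_mod_cast h1
    have h2' : (n : ℝ) ^ (ℓ - h) ≤
        q * (((e : ℝ) + 1) ^ h * ((n - h * (e + 1)).choose (ℓ - h) : ℝ)) := by
      exact_mod_cast h2
    rw [← div_le_iff₀' hq0'] at h2'
    rw [remainder, one_div_mul_eq_div]
    linarith
  · obtain ⟨S, hSh, hSd, hle⟩ := exists_commonBall_of_mem_channelCounts hmax.1
    have h1 := hle.trans (hK n (by omega) S hSh hSd)
    have h1' : (maxChannels n ℓ e h : ℝ) ≤ (ballVolume n (ℓ - 1) : ℝ) +
        ((e : ℝ) + 1) ^ h * ((n - h * (e + 1)).choose (ℓ + 1 - h) : ℝ) +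
        K * (n : ℝ) ^ (ℓ - h) := by
      exact_mod_cast h1
    have h2 : (0 : ℝ) ≤ (n : ℝ) ^ (ℓ - h) := by positivity
    rw [remainder]
    linarith
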